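/- Let $(M,g)$ be a connected (non-empty), complete, finite-dimensional smooth Riemannian manifold without boundary, with distance function $d\colon M\times M\to\mathbb{R}$. Let $f\in C^\infty(M;\mathbb{R})$ be a non-negative Morse function, i.e. $f\ge 0$ and the Hessian of $f$ at every critical point is a nondegenerate bilinear form. Write $\|\mathrm{d}f\|_g$ for the pointwise norm of the covector $\mathrm{d}f$ with respect to $g$. Suppose that there is a constant $c>0$ with $f(x)\le c\,\|\mathrm{d}f(x)\|_g$ for all $x\in M$. Then: 1. A point $x\in M$ is a critical point of $f$ if and only if $f(x)=0$, and every critical point of $f$ is a local minimum. 2. $\inf_M f=0$. Furthermore, if $f$ attains its infimum at some $x_{\min}\in M$, then $f(x_{\min})=0$, and every sequence $(x_n)$ in $M$ with $f(x_n)\to 0$ converges to $x_{\min}$. In particular, $f$ has at most one critical point. 3. If in addition there is a constant $c'>0$ with $f(x)^{1/2}\le c'\,\|\mathrm{d}f(x)\|_g$ for all $x\in M$, then $f$ has exactly one critical point. -/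

import Mathlib

open Set Filter Topology
open scoped Manifold ContDiff Bundle

noncomputable section

/-- The differential `d f_x` of a real function on a manifold, as a covector at `x`. -/
def differentialAt {E : Type*} [NormedAddCommGroup E] [NormedSpace ℝ E]
    {M : Type*} [TopologicalSpace M] [ChartedSpace E M] (f : M → ℝ) (x : M) :
    TangentSpace 𝓘(ℝ, E) x →L[ℝ] ℝ :=
  mfderiv 𝓘(ℝ, E) 𝓘(ℝ, ℝ) f x

/-- The norm `‖d f_x‖_g` of the differential: the operator norm of the covector `d f_x` with respect
to the norm on the tangent space `T_x M` given by the Riemannian metric. -/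
def differentialNorm (E : Type*) [NormedAddCommGroup E] [NormedSpace ℝ E]
    {M : Type*} [TopologicalSpace M] [ChartedSpace E M]
    [Bundle.RiemannianBundle (fun x : M ↦ TangentSpace 𝓘(ℝ, E) x)]
    (f : M → ℝ) (x : M) : ℝ :=
  ‖differentialAt (E := E) f x‖

/-- `x` is a critical point of `f` if `d f_x = 0`. -/
def IsCriticalPoint (E : Type*) [NormedAddCommGroup E] [NormedSpace ℝ E]
    {M : Type*} [TopologicalSpace M] [ChartedSpace E M] (f : M → ℝ) (x : M) : Prop :=
  differentialAt (E := E) f x = 0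

/-- The Hessian of `f` at `x`, read in the preferred chart around `x`: the second derivative of
`f ∘ φ⁻¹` at `φ x`. At a critical point its nondegeneracy does not depend on the chart. -/
def chartHessian (E : Type*) [NormedAddCommGroup E] [NormedSpace ℝ E]
    {M : Type*} [TopologicalSpace M] [ChartedSpace E M] (f : M → ℝ) (x : M) :
    E →L[ℝ] E →L[ℝ] ℝ :=
  fderiv ℝ (fderiv ℝ (f ∘ (chartAt E x).symm)) (chartAt E x x)

/-- `f` is a Morse function: every critical point of `f` is nondegenerate, that is, the Hessian
there is a nondegenerate (symmetric) bilinear form. Smoothness of `f` is stated separately. -/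
def IsMorse (E : Type*) [NormedAddCommGroup E] [NormedSpace ℝ E]
    {M : Type*} [TopologicalSpace M] [ChartedSpace E M] (f : M → ℝ) : Prop :=
  ∀ x : M, IsCriticalPoint E f x →
    ∀ v : E, (∀ w : E, chartHessian E f x v w = 0) → v = 0

/-- `A ≲ B` (equivalently `B ≳ A`) for real functions: `A ≤ c B` everywhere, for some constant
`c > 0`. -/
def Dominated {M : Type*} (A B : M → ℝ) : Prop :=
  ∃ c : ℝ, 0 < c ∧ ∀ x : M, A x ≤ c * B x

end

section Metric

variable {M : Type*} [MetricSpace M]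

/-- The Caristi–Ekeland principle: a nonnegative continuous function on a complete set has a point
that is minimal for the order `κ * dist x y ≤ f x - f y`. -/
theorem IsClosed.exists_caristi_minimal [CompleteSpace M] {s : Set M} (hs : IsClosed s)
    (hne : s.Nonempty) {f : M → ℝ} (hf : Continuous f) (h0 : ∀ x, 0 ≤ f x) {κ : ℝ} (hκ : 0 < κ) :
    ∃ x ∈ s, ∀ y ∈ s, κ * dist x y ≤ f x - f y → y = x := by
  have step : ∀ x : s, ∃ y : s, κ * dist (x : M) y ≤ f x - f y ∧
      ∀ z ∈ s, κ * dist (x : M) z ≤ f x - f z → 2 * f y ≤ f x + f z := by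
    intro x
    set S : Set M := {z | z ∈ s ∧ κ * dist (x : M) z ≤ f x - f z} with hS
    have hxS : (x : M) ∈ S := ⟨x.2, by simp⟩
    have hb : BddBelow (f '' S) := ⟨0, by rintro _ ⟨z, -, rfl⟩; exact h0 z⟩
    have hle : ∀ z ∈ S, sInf (f '' S) ≤ f z := fun z hz ↦ csInf_le hb ⟨z, hz, rfl⟩
    rcases (hle x hxS).lt_or_eq with h | h
    · obtain ⟨_, ⟨y, hy, rfl⟩, hlt⟩ := exists_lt_of_csInf_lt (⟨f x, x, hxS, rfl⟩ : (f '' S).Nonempty)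
        (show sInf (f '' S) < (f x + sInf (f '' S)) / 2 by linarith)
      refine ⟨⟨y, hy.1⟩, hy.2, fun z hz hxz ↦ ?_⟩
      have := hle z ⟨hz, hxz⟩
      simp only
      linarith
    · refine ⟨x, by simp, fun z hz hxz ↦ ?_⟩
      have := hle z ⟨hz, hxz⟩
      linarith
  choose g hg1 hg2 using step
  obtain ⟨a, ha⟩ := hne
  let u : ℕ → s := fun n ↦ g^[n] ⟨a, ha⟩
  have hu : ∀ n, u (n + 1) = g (u n) := fun n ↦ Function.iterate_succ_apply' g n _
  have mono : ∀ n k, κ * dist (u n : M) (u (n + k)) ≤ f (u n) - f (u (n + k)) := by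
    intro n k
    induction k with
    | zero => simp
    | succ k ih =>
      have h1 := hg1 (u (n + k))
      rw [← hu] at h1
      have h2 := mul_le_mul_of_nonneg_left
        (dist_triangle (u n : M) (u (n + k)) (u (n + k + 1))) hκ.le
      rw [← add_assoc]
      linarith
  have anti : Antitone fun n ↦ f (u n) := by
    refine antitone_nat_of_succ_le fun n ↦ ?_
    have := mono n 1
    have h2 : 0 ≤ κ * dist (u n : M) (u (n + 1)) := by positivity
    linarith
  have hconv := tendsto_atTop_ciInf anti ⟨0, by rintro _ ⟨n, rfl⟩; exact h0 _⟩
  have hcau : CauchySeq fun n ↦ (u n : M) := by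
    have hc := hconv.cauchySeq
    rw [Metric.cauchySeq_iff'] at hc ⊢
    intro ε hε
    obtain ⟨N, hN⟩ := hc (κ * ε) (by positivity)
    refine ⟨N, fun n hn ↦ ?_⟩
    obtain ⟨k, rfl⟩ := Nat.exists_eq_add_of_le hn
    have h1 := hN (N + k) hn
    rw [Real.dist_eq, abs_sub_comm] at h1
    have h2 := (mono N k).trans_lt ((le_abs_self _).trans_lt h1)
    rw [dist_comm]
    exact lt_of_mul_lt_mul_left h2 hκ.le
  obtain ⟨x, hx⟩ := cauchySeq_tendsto_of_complete hcau
  have hfx : Tendsto (fun n ↦ f (u n)) atTop (𝓝 (f x)) := (hf.tendsto x).comp hx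
  have hux : ∀ n, κ * dist (u n : M) x ≤ f (u n) - f x := fun n ↦ by
    refine le_of_tendsto_of_tendsto ((tendsto_const_nhds.dist hx).const_mul κ)
      (tendsto_const_nhds.sub hfx) ?_
    filter_upwards [eventually_ge_atTop n] with m hm
    obtain ⟨k, rfl⟩ := Nat.exists_eq_add_of_le hm
    exact mono n k
  refine ⟨x, hs.mem_of_tendsto hx (Eventually.of_forall fun n ↦ (u n).2), fun z hz hxz ↦ ?_⟩
  have h1 : 2 * f x ≤ f x + f z := by
    refine le_of_tendsto_of_tendsto ((hfx.comp (tendsto_add_atTop_nat 1)).const_mul 2)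
      (hfx.add_const (f z)) (Eventually.of_forall fun n ↦ ?_)
    simp only [Function.comp_apply]
    rw [hu]
    refine hg2 _ z hz ?_
    have h2 := mul_le_mul_of_nonneg_left (dist_triangle (u n : M) x z) hκ.le
    have := hux n
    linarith
  have h2 : dist x z ≤ 0 := by
    by_contra! h
    have : 0 < κ * dist x z := by positivity
    linarith
  exact (dist_le_zero.1 h2).symm

/-- There is a path from `x` to `y` along which `f` decreases at rate at least `κ` with respect to
the distance. -/
def SteepPath (f : M → ℝ) (κ : ℝ) (x y : M) : Prop :=
  ∃ (a b : ℝ) (γ : ℝ → M), a ≤ b ∧ ContinuousOn γ (Icc a b) ∧ γ a = x ∧ γ b = y ∧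
    ∀ s ∈ Icc a b, ∀ t ∈ Icc a b, s ≤ t → κ * dist (γ s) (γ t) ≤ f (γ s) - f (γ t)

theorem SteepPath.refl (f : M → ℝ) (κ : ℝ) (x : M) : SteepPath f κ x x :=
  ⟨0, 0, fun _ ↦ x, le_rfl, continuousOn_const, rfl, rfl, by simp⟩

theorem SteepPath.le {f : M → ℝ} {κ : ℝ} {x y : M} (h : SteepPath f κ x y) :
    κ * dist x y ≤ f x - f y := by
  obtain ⟨a, b, γ, hab, -, rfl, rfl, h⟩ := h
  exact h a (left_mem_Icc.2 hab) b (right_mem_Icc.2 hab) hab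

theorem SteepPath.trans {f : M → ℝ} {κ : ℝ} (hκ : 0 ≤ κ) {x y z : M} (h : SteepPath f κ x y)
    (h' : SteepPath f κ y z) : SteepPath f κ x z := by
  obtain ⟨a, b, γ, hab, hc, rfl, rfl, h⟩ := h
  obtain ⟨a', b', γ', hab', hc', ha', rfl, h'⟩ := h'
  let δ : ℝ → M := fun t ↦ if t ≤ b then γ t else γ' (t - b + a')
  have h1 : ∀ t ≤ b, δ t = γ t := fun t ht ↦ if_pos ht
  have h2 : ∀ t, b ≤ t → δ t = γ' (t - b + a') := fun t ht ↦ by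
    rcases ht.eq_or_lt with rfl | ht
    · simp [δ, ha']
    · exact if_neg ht.not_ge
  have hs1 : ∀ s ∈ Icc a b, ∀ t ∈ Icc a b, s ≤ t → κ * dist (δ s) (δ t) ≤ f (δ s) - f (δ t) :=
    fun s hs t ht hst ↦ by rw [h1 s hs.2, h1 t ht.2]; exact h s hs t ht hst
  have hs2 : ∀ s ∈ Icc b (b + (b' - a')), ∀ t ∈ Icc b (b + (b' - a')), s ≤ t →
      κ * dist (δ s) (δ t) ≤ f (δ s) - f (δ t) := fun s hs t ht hst ↦ by
    rw [h2 s hs.1, h2 t ht.1]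
    exact h' _ ⟨by linarith [hs.1], by linarith [hs.2]⟩ _ ⟨by linarith [ht.1], by linarith [ht.2]⟩
      (by linarith)
  have hbb : b ≤ b + (b' - a') := by linarith
  refine ⟨a, b + (b' - a'), δ, by linarith, ?_, h1 a hab, ?_, ?_⟩
  · rw [← Icc_union_Icc_eq_Icc hab hbb]
    refine ContinuousOn.union_of_isClosed (hc.congr fun t ht ↦ h1 t ht.2) ?_ isClosed_Icc
      isClosed_Icc
    refine ContinuousOn.congr (f := fun t ↦ γ' (t - b + a')) ?_ fun t ht ↦ h2 t ht.1
    exact hc'.comp (by fun_prop) fun t ht ↦ ⟨by linarith [ht.1], by linarith [ht.2]⟩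
  · rw [h2 _ hbb]; congr 1; ring
  · intro s hs t ht hst
    rcases le_total t b with htb | htb
    · exact hs1 s ⟨hs.1, hst.trans htb⟩ t ⟨ht.1, htb⟩ hst
    rcases le_total b s with hsb | hsb
    · exact hs2 s ⟨hsb, hs.2⟩ t ⟨htb, ht.2⟩ hst
    · have e1 := hs1 s ⟨hs.1, hsb⟩ b (right_mem_Icc.2 hab) hsb
      have e2 := hs2 b (left_mem_Icc.2 hbb) t ⟨htb, ht.2⟩ htb
      have e3 := mul_le_mul_of_nonneg_left (dist_triangle (δ s) (δ b) (δ t)) hκ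
      linarith

/-- A steep path cannot leave a set on whose frontier `f` is large. -/
theorem SteepPath.mem_of_frontier {f : M → ℝ} {κ η : ℝ} (hκ : 0 ≤ κ) {C : Set M}
    (hC : ∀ z ∈ frontier C, η ≤ f z) {x y : M} (h : SteepPath f κ x y) (hx : f x < η)
    (hy : y ∈ C) : x ∈ C := by
  obtain ⟨a, b, γ, hab, hc, rfl, rfl, h⟩ := h
  by_contra hxC
  have ha := left_mem_Icc.2 hab
  have hb := right_mem_Icc.2 hab
  have hfr : ∀ t ∈ Icc a b, γ t ∉ frontier C := fun t ht htf ↦ by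
    have h1 := hC _ htf
    have h2 := h a ha t ht ht.1
    have h3 : 0 ≤ κ * dist (γ a) (γ t) := by positivity
    linarith
  obtain ⟨z, -, hz, hz'⟩ := isPreconnected_Icc.image γ hc (interior C) (closure C)ᶜ
    isOpen_interior isClosed_closure.isOpen_compl
    (by
      rintro _ ⟨t, ht, rfl⟩
      by_contra! hcon
      exact hfr t ht ⟨by_contra fun h ↦ hcon (Or.inr h), fun h ↦ hcon (Or.inl h)⟩)
    ⟨γ b, ⟨b, hb, rfl⟩, by_contra fun h ↦ hfr b hb ⟨subset_closure hy, h⟩⟩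
    ⟨γ a, ⟨a, ha, rfl⟩, fun h ↦ hfr a ha ⟨h, fun h' ↦ hxC (interior_subset h')⟩⟩
  exact hz' (subset_closure (interior_subset hz))

/-- A steep path that goes away from `y` passes through each sphere around `y`. -/
theorem SteepPath.exists_dist_eq {f : M → ℝ} {κ r : ℝ} {x y z : M} (h : SteepPath f κ x z)
    (hx : dist y x ≤ r) (hz : r ≤ dist y z) :
    ∃ w, dist y w = r ∧ SteepPath f κ x w ∧ SteepPath f κ w z := by
  obtain ⟨a, b, γ, hab, hc, rfl, rfl, h⟩ := h
  obtain ⟨t, ht, hr⟩ := intermediate_value_Icc hab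
    (f := fun t ↦ dist y (γ t)) (by fun_prop) ⟨hx, hz⟩
  refine ⟨γ t, hr, ⟨a, t, γ, ht.1, hc.mono (Icc_subset_Icc_right ht.2), rfl, rfl, ?_⟩,
    ⟨t, b, γ, ht.2, hc.mono (Icc_subset_Icc_left ht.1), rfl, rfl, ?_⟩⟩
  · exact fun s hs s' hs' ↦ h s ⟨hs.1, hs.2.trans ht.2⟩ s' ⟨hs'.1, hs'.2.trans ht.2⟩
  · exact fun s hs s' hs' ↦ h s ⟨ht.1.trans hs.1, hs.2⟩ s' ⟨ht.1.trans hs'.1, hs'.2⟩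

/-- Near `x` there are steep paths of rate `κ` on which `f` decreases by a definite amount. -/
def LocallySteep (f : M → ℝ) (κ : ℝ) (x : M) : Prop :=
  ∃ δ > 0, ∀ᶠ y in 𝓝 x, ∃ z, SteepPath f κ y z ∧ δ ≤ f y - f z

/-- Up to an arbitrarily small loss in the slope, the points near `x` at which `f` is lower than
at `x` by a definite slope form a connected set. -/
def DescentConnected (f : M → ℝ) (x : M) : Prop :=
  ∀ κ₁ κ₂ : ℝ, 0 < κ₂ → κ₂ < κ₁ → ∃ S : Set M, IsPreconnected S ∧
    (∀ᶠ y in 𝓝 x, y ≠ x → κ₁ * dist x y ≤ f x - f y → y ∈ S) ∧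
    ∀ z ∈ S, z ≠ x ∧ κ₂ * dist x z ≤ f x - f z

/-- The closure of the set of starting points of steep paths that end in `C` below level `c`. -/
def basin (f : M → ℝ) (κ c : ℝ) (C : Set M) : Set M :=
  closure {x | ∃ a ∈ C, f a < c ∧ SteepPath f κ x a}

theorem mem_of_mem_basin {f : M → ℝ} (hf : Continuous f) {κ c η : ℝ} (hκ : 0 ≤ κ) {C : Set M}
    (hC : ∀ z ∈ frontier C, η ≤ f z) {x : M} (hx : x ∈ basin f κ c C) (hxη : f x < η) :
    x ∈ C := by
  by_contra hxC
  have hcl : x ∈ closure C := by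
    rw [mem_closure_iff_nhds]
    intro U hU
    obtain ⟨z, ⟨hzU, hz⟩, a, haC, -, hza⟩ := mem_closure_iff_nhds.1 hx _
      (inter_mem hU ((isOpen_Iio.preimage hf).mem_nhds hxη))
    exact ⟨z, hzU, hza.mem_of_frontier hκ hC hz haC⟩
  exact (hC x ⟨hcl, fun h ↦ hxC (interior_subset h)⟩).not_gt hxη

theorem exists_steepPath_lt [CompleteSpace M] {f : M → ℝ} (hf : Continuous f) (h0 : ∀ x, 0 ≤ f x)
    {κ c : ℝ} (hκ : 0 < κ) (H : ∀ x, c ≤ f x → LocallySteep f κ x) (x : M) :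
    ∃ a, f a < c ∧ SteepPath f κ x a := by
  by_contra! hcon
  obtain ⟨y, hy, hmin⟩ := (isClosed_closure (s := {a | SteepPath f κ x a})).exists_caristi_minimal
    ⟨x, subset_closure (SteepPath.refl f κ x)⟩ hf h0 (half_pos hκ)
  have hcy : c ≤ f y := by
    have : closure {a | SteepPath f κ x a} ⊆ {a | c ≤ f a} :=
      closure_minimal (fun a ha ↦ not_lt.1 fun h ↦ hcon a h ha) (isClosed_Ici.preimage hf)
    exact this hy
  obtain ⟨δ, hδ, hev⟩ := H y hcy
  have hev2 : ∀ᶠ z in 𝓝 y, f z - f y + κ * dist y z < δ / 2 := by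
    have : ContinuousAt (fun z ↦ f z - f y + κ * dist y z) y := by fun_prop
    exact this.eventually_lt_const (by simpa using half_pos hδ)
  obtain ⟨z, ⟨⟨w, hzw, hw⟩, hz⟩, hxz⟩ := mem_closure_iff_nhds.1 hy _ (hev.and hev2)
  have h1 := hzw.le
  have h2 := mul_le_mul_of_nonneg_left (dist_triangle y z w) hκ.le
  have h3 : 0 ≤ κ * dist y z := by positivity
  have := hmin w (subset_closure (SteepPath.trans hκ.le hxz hzw)) (by linarith)
  subst this
  have h4 : 0 ≤ κ * dist w z := by positivity
  linarith

theorem exists_mem_basin_near {f : M → ℝ} (hf : Continuous f) {κ κ' c : ℝ} (hκ : κ' < κ)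
    (hκ' : 0 < κ') {C : Set M} {x : M} (hx : x ∈ basin f κ c C) (hxc : c < f x) {p : M → Prop}
    (hp : ∀ᶠ y in 𝓝 x, p y) :
    ∃ y ∈ basin f κ c C, p y ∧ y ≠ x ∧ κ' * dist x y ≤ f x - f y := by
  obtain ⟨R, hR, hball⟩ := Metric.eventually_nhds_iff.1
    (hp.and (hf.continuousAt.eventually_const_lt hxc))
  set r := R / 2 with hr
  have hr0 : 0 < r := half_pos hR
  have hev : ∀ᶠ z in 𝓝 x, κ' * r < κ * (r - dist x z) - (f z - f x) := by
    have : ContinuousAt (fun z ↦ κ * (r - dist x z) - (f z - f x)) x := by fun_prop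
    exact this.eventually_const_lt (by simpa using mul_lt_mul_of_pos_right hκ hr0)
  obtain ⟨z, ⟨hz, hzr⟩, a, haC, hac, hza⟩ := mem_closure_iff_nhds.1 hx _
    (hev.and (Metric.ball_mem_nhds x hr0))
  have haR : R ≤ dist x a := by
    by_contra! h
    rw [dist_comm] at h
    exact (hball h).2.not_gt hac
  obtain ⟨w, hw, hzw, hwa⟩ := hza.exists_dist_eq (y := x) (r := r)
    (by rw [dist_comm]; exact (Metric.mem_ball.1 hzr).le) (by linarith)
  refine ⟨w, subset_closure ⟨a, haC, hac, hwa⟩,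
    (hball (by rw [dist_comm, hw]; linarith)).1, ?_, ?_⟩
  · rintro rfl
    simp at hw
    linarith
  · have h1 := hzw.le
    have h3 : r - dist x z ≤ dist z w := by
      have := dist_triangle x z w
      linarith
    have h4 := mul_le_mul_of_nonneg_left h3 (hκ'.trans hκ).le
    rw [hw]
    linarith

/-- A mountain pass principle: if `f` is steep above the level `η / 2`, then a sublevel set
`{f < η}` that meets `A` is contained in `A`, provided that `f ≥ η` on the frontier of `A`. -/
theorem mem_of_lt_of_frontier_le [CompleteSpace M] [PreconnectedSpace M] {f : M → ℝ}
    (hf : Continuous f) (h0 : ∀ x, 0 ≤ f x) {κ η : ℝ} (hκ : 0 < κ) (hη : 0 < η)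
    (H1 : ∀ x, η / 2 ≤ f x → LocallySteep f κ x) (H2 : ∀ x, DescentConnected f x)
    {A : Set M} (hA : ∀ z ∈ frontier A, η ≤ f z) {x₀ : M} (hx₀ : x₀ ∈ A) (hfx₀ : f x₀ < η)
    {p : M} (hp : f p < η) : p ∈ A := by
  by_contra hpA
  set P := basin f κ (η / 2) A
  set Q := basin f κ (η / 2) Aᶜ
  have hA' : ∀ z ∈ frontier Aᶜ, η ≤ f z := by rwa [frontier_compl]
  have hPQ : ∀ x, x ∈ P ∪ Q := fun x ↦ by
    obtain ⟨a, ha, hxa⟩ := exists_steepPath_lt hf h0 hκ H1 x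
    by_cases haA : a ∈ A
    · exact Or.inl (subset_closure ⟨a, haA, ha, hxa⟩)
    · exact Or.inr (subset_closure ⟨a, haA, ha, hxa⟩)
  have hPA : ∀ x ∈ P, f x < η → x ∈ A := fun x hx ↦ mem_of_mem_basin hf hκ.le hA hx
  have hQA : ∀ x ∈ Q, f x < η → x ∉ A := fun x hx ↦ mem_of_mem_basin hf hκ.le hA' hx
  have hx₀P : x₀ ∈ P := (hPQ x₀).resolve_right fun h ↦ hQA x₀ h hfx₀ hx₀
  have hpQ : p ∈ Q := (hPQ p).resolve_left fun h ↦ hpA (hPA p h hp)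
  have cP : IsClosed P := isClosed_closure
  have cQ : IsClosed Q := isClosed_closure
  obtain ⟨q, -, hq⟩ := isPreconnected_closed_iff.1 isPreconnected_univ P Q cP cQ
    (fun x _ ↦ hPQ x) ⟨x₀, trivial, hx₀P⟩ ⟨p, trivial, hpQ⟩
  obtain ⟨x, ⟨hxP, hxQ⟩, hmin⟩ := (cP.inter cQ).exists_caristi_minimal ⟨q, hq⟩ hf h0
    (κ := κ / 4) (by positivity)
  have hxη : η / 2 < f x := by
    by_contra! h
    exact hQA x hxQ (by linarith) (hPA x hxP (by linarith))
  obtain ⟨S, hS, hnear, hSx⟩ := H2 x (κ / 2) (κ / 4) (by positivity) (by linarith)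
  obtain ⟨y, hy, hyS, hyx, hle⟩ := exists_mem_basin_near hf (κ' := κ / 2) (by linarith)
    (by positivity) hxP hxη hnear
  obtain ⟨y', hy', hyS', hyx', hle'⟩ := exists_mem_basin_near hf (κ' := κ / 2) (by linarith)
    (by positivity) hxQ hxη hnear
  obtain ⟨z, hzS, hz⟩ := isPreconnected_closed_iff.1 hS P Q cP cQ (fun x _ ↦ hPQ x)
    ⟨y, hyS hyx hle, hy⟩ ⟨y', hyS' hyx' hle', hy'⟩
  exact (hSx z hzS).1 (hmin z hz (hSx z hzS).2)

end Metric

section Param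

variable {M : Type*} [MetricSpace M] {F : Type*} [NormedAddCommGroup F] [NormedSpace ℝ F]

/-- `ψ` parametrizes a neighborhood of `x = ψ 0` by a ball of radius `ρ`, distorting distances by a
factor at most `r`: the upper bound holds for all pairs of points, the lower one for the distance
to the center. -/
structure AlmostIsometricParam (ψ : F → M) (x : M) (r ρ : ℝ) : Prop where
  map_zero : ψ 0 = x
  radius_pos : 0 < ρ
  image_mem_nhds : ψ '' Metric.ball 0 ρ ∈ 𝓝 x
  dist_le : ∀ z ∈ Metric.ball (0 : F) ρ, ∀ w ∈ Metric.ball (0 : F) ρ,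
    dist (ψ z) (ψ w) ≤ r * ‖z - w‖
  norm_le : ∀ z ∈ Metric.ball (0 : F) ρ, ‖z‖ ≤ r * dist x (ψ z)

namespace AlmostIsometricParam

variable {ψ : F → M} {x : M} {r ρ : ℝ}

omit [NormedSpace ℝ F] in
theorem mono (h : AlmostIsometricParam ψ x r ρ) (hr : 0 < r) {ρ' : ℝ} (h0 : 0 < ρ')
    (hρ : ρ' ≤ ρ) : AlmostIsometricParam ψ x r ρ' where
  map_zero := h.map_zero
  radius_pos := h0
  image_mem_nhds := by
    filter_upwards [h.image_mem_nhds, Metric.ball_mem_nhds x (div_pos h0 hr)]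
    rintro _ ⟨z, hz, rfl⟩ hd
    refine ⟨z, ?_, rfl⟩
    rw [mem_ball_zero_iff]
    rw [Metric.mem_ball', lt_div_iff₀' hr] at hd
    exact (h.norm_le z hz).trans_lt hd
  dist_le z hz w hw := h.dist_le z (Metric.ball_subset_ball hρ hz) w (Metric.ball_subset_ball hρ hw)
  norm_le z hz := h.norm_le z (Metric.ball_subset_ball hρ hz)

theorem exists_strict_approx (h : AlmostIsometricParam ψ x r ρ) (hr : 0 < r) {f : M → ℝ}
    {L : F →L[ℝ] ℝ} (hL : HasStrictFDerivAt (f ∘ ψ) L 0) {ε : ℝ} (hε : 0 < ε) :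
    ∃ ρ', AlmostIsometricParam ψ x r ρ' ∧ ∀ z ∈ Metric.ball (0 : F) ρ',
      ∀ w ∈ Metric.ball (0 : F) ρ', |f (ψ z) - f (ψ w) - L (z - w)| ≤ ε * ‖z - w‖ := by
  have h1 := hL.isLittleO.def hε
  rw [nhds_prod_eq] at h1
  obtain ⟨δ, hδ, hb⟩ := (Metric.nhds_basis_ball.prod_self.eventually_iff).1 h1
  refine ⟨min δ ρ, h.mono hr (lt_min hδ h.radius_pos) (min_le_right _ _), fun z hz w hw ↦ ?_⟩
  exact hb (x := (z, w)) ⟨Metric.ball_subset_ball (min_le_left _ _) hz,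
    Metric.ball_subset_ball (min_le_left _ _) hw⟩

theorem locallySteep (h : AlmostIsometricParam ψ x r ρ) (hr : 0 < r) {f : M → ℝ}
    {L : F →L[ℝ] ℝ} (hL : HasStrictFDerivAt (f ∘ ψ) L 0) {κ : ℝ} (hκ : 0 < κ)
    (hκL : κ * r < ‖L‖) : LocallySteep f κ x := by
  obtain ⟨v, hv⟩ : ∃ v, κ * r * ‖v‖ < -L v := by
    by_contra! hcon
    refine hκL.not_ge (L.opNorm_le_bound (by positivity) fun v ↦ abs_le'.2 ⟨?_, hcon v⟩)
    simpa using hcon (-v)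
  have hv0 : 0 < ‖v‖ := norm_pos_iff.2 (by rintro rfl; simp at hv)
  obtain ⟨ρ', h', happ⟩ := h.exists_strict_approx hr hL
    (ε := (-L v - κ * r * ‖v‖) / ‖v‖) (div_pos (by linarith) hv0)
  have hρ' := h'.radius_pos
  have hh := h'.mono hr (half_pos hρ') (by linarith)
  set τ := ρ' / 2 / ‖v‖ with hτ
  have hτ0 : 0 < τ := by positivity
  have hτv : τ * ‖v‖ = ρ' / 2 := by rw [hτ]; field_simp
  refine ⟨τ * (κ * r * ‖v‖), by positivity, ?_⟩
  filter_upwards [hh.image_mem_nhds]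
  rintro _ ⟨z, hz, rfl⟩
  have hball : ∀ t ∈ Icc 0 τ, z + t • v ∈ Metric.ball (0 : F) ρ' := fun t ht ↦ by
    rw [mem_ball_zero_iff] at hz ⊢
    have h1 := norm_add_le z (t • v)
    rw [norm_smul, Real.norm_of_nonneg ht.1] at h1
    have h2 := mul_le_mul_of_nonneg_right ht.2 hv0.le
    linarith
  have key : ∀ s ∈ Icc 0 τ, ∀ t ∈ Icc 0 τ, s ≤ t →
      (t - s) * (κ * r * ‖v‖) ≤ f (ψ (z + s • v)) - f (ψ (z + t • v)) := fun s hs t ht hst ↦ by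
    have h1 := (abs_le.1 (happ _ (hball s hs) _ (hball t ht))).1
    have e : z + s • v - (z + t • v) = -((t - s) • v) := by module
    rw [e, norm_neg, norm_smul, Real.norm_of_nonneg (sub_nonneg.2 hst), map_neg, map_smul,
      smul_eq_mul] at h1
    have e2 : (-L v - κ * r * ‖v‖) / ‖v‖ * ((t - s) * ‖v‖) = (t - s) * (-L v - κ * r * ‖v‖) := by
      field_simp
    rw [e2] at h1
    linarith
  have hdist : ∀ s ∈ Icc 0 τ, ∀ t ∈ Icc 0 τ,
      dist (ψ (z + s • v)) (ψ (z + t • v)) ≤ r * ‖v‖ * |s - t| := fun s hs t ht ↦ by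
    have h1 := h'.dist_le _ (hball s hs) _ (hball t ht)
    have e : z + s • v - (z + t • v) = (s - t) • v := by module
    rw [e, norm_smul, Real.norm_eq_abs] at h1
    linarith
  refine ⟨ψ (z + τ • v), ⟨0, τ, fun t ↦ ψ (z + t • v), hτ0.le, ?_, by simp, rfl, ?_⟩, ?_⟩
  · have : LipschitzOnWith (r * ‖v‖).toNNReal (fun t : ℝ ↦ ψ (z + t • v)) (Icc 0 τ) := by
      refine LipschitzOnWith.of_dist_le_mul fun s hs t ht ↦ ?_
      rw [Real.coe_toNNReal _ (by positivity), Real.dist_eq]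
      exact hdist s hs t ht
    exact this.continuousOn
  · intro s hs t ht hst
    have h1 := mul_le_mul_of_nonneg_left (hdist s hs t ht) hκ.le
    rw [abs_sub_comm, abs_of_nonneg (sub_nonneg.2 hst)] at h1
    have h2 := key s hs t ht hst
    dsimp only
    linarith
  · simpa using key 0 (left_mem_Icc.2 hτ0.le) τ (right_mem_Icc.2 hτ0.le) hτ0.le

theorem exists_descent_set (h : AlmostIsometricParam ψ x r ρ) (hr : 1 ≤ r) {f : M → ℝ}
    {L : F →L[ℝ] ℝ} (hL : HasStrictFDerivAt (f ∘ ψ) L 0) {κ₁ κ₂ : ℝ} (h₂ : 0 < κ₂)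
    (h₁ : κ₂ * r ^ 2 < κ₁) : ∃ S : Set M, IsPreconnected S ∧
      (∀ᶠ y in 𝓝 x, y ≠ x → κ₁ * dist x y ≤ f x - f y → y ∈ S) ∧
      ∀ z ∈ S, z ≠ x ∧ κ₂ * dist x z ≤ f x - f z := by
  have hr0 : 0 < r := one_pos.trans_le hr
  set ε := (κ₁ - κ₂ * r ^ 2) / (2 * r) with hε
  have hε0 : 0 < ε := div_pos (by linarith) (by linarith)
  obtain ⟨ρ', h', happ⟩ := h.exists_strict_approx hr0 hL hε0
  have hκ₁ : κ₁ = r * (κ₂ * r + 2 * ε) := by rw [hε]; field_simp; ring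
  have h00 : (0 : F) ∈ Metric.ball (0 : F) ρ' := Metric.mem_ball_self h'.radius_pos
  have hκε : 0 < κ₂ * r + ε := by positivity
  set T : Set F := {w | w ∈ Metric.ball 0 ρ' ∧ (κ₂ * r + ε) * ‖w‖ ≤ -L w ∧ 0 < -L w} with hT
  have hconv : Convex ℝ T := by
    rintro w ⟨hw, hw', hw''⟩ w₁ ⟨hw₁, hw₁', hw₁''⟩ a b ha hb hab
    refine ⟨convex_ball _ _ hw hw₁ ha hb hab, ?_, ?_⟩
    · have e1 := norm_add_le (a • w) (b • w₁)
      rw [norm_smul, norm_smul, Real.norm_of_nonneg ha, Real.norm_of_nonneg hb] at e1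
      have e2 := mul_le_mul_of_nonneg_left e1 hκε.le
      have e3 := mul_le_mul_of_nonneg_left hw' ha
      have e4 := mul_le_mul_of_nonneg_left hw₁' hb
      simp only [map_add, map_smul, smul_eq_mul]
      linarith
    · simp only [map_add, map_smul, smul_eq_mul]
      rcases ha.eq_or_lt with rfl | ha
      · obtain rfl : b = 1 := by linarith
        linarith
      · have e3 := mul_pos ha hw''
        have e4 := mul_nonneg hb hw₁''.le
        linarith
  have hcont : ContinuousOn ψ (Metric.ball 0 ρ') :=
    (LipschitzOnWith.of_dist_le_mul (K := r.toNNReal) fun z hz w hw ↦ by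
      rw [Real.coe_toNNReal _ hr0.le, dist_eq_norm z w]
      exact h'.dist_le z hz w hw).continuousOn
  refine ⟨ψ '' T, hconv.isPreconnected.image ψ (hcont.mono fun w hw ↦ hw.1), ?_, ?_⟩
  · filter_upwards [h'.image_mem_nhds]
    rintro _ ⟨z, hz, rfl⟩ hne hle
    have hz0 : 0 < ‖z‖ := norm_pos_iff.2 (by rintro rfl; exact hne h'.map_zero)
    have e1 := (abs_le.1 (happ z hz 0 h00)).1
    rw [sub_zero, h'.map_zero] at e1
    have e2 := mul_le_mul_of_nonneg_left (h'.norm_le z hz)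
      (show 0 ≤ κ₂ * r + 2 * ε by positivity)
    rw [hκ₁] at hle
    have e3 : (κ₂ * r + ε) * ‖z‖ ≤ -L z := by linarith
    exact ⟨z, ⟨hz, e3, lt_of_lt_of_le (by positivity) e3⟩, rfl⟩
  · rintro _ ⟨z, ⟨hz, hz1, hz2⟩, rfl⟩
    constructor
    · intro heq
      have e1 := h'.norm_le z hz
      rw [heq, dist_self, mul_zero, norm_le_zero_iff] at e1
      simp [e1] at hz2
    · have e1 := (abs_le.1 (happ z hz 0 h00)).2
      rw [sub_zero, h'.map_zero] at e1
      have e2 := h'.dist_le 0 h00 z hz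
      rw [h'.map_zero, zero_sub, norm_neg] at e2
      have e3 := mul_le_mul_of_nonneg_left e2 h₂.le
      linarith

end AlmostIsometricParam

end Param

section Riemannian

variable {E : Type*} [NormedAddCommGroup E] [NormedSpace ℝ E]
  {M : Type*} [MetricSpace M] [ChartedSpace E M] [IsManifold 𝓘(ℝ, E) 1 M]
  [Bundle.RiemannianBundle (fun x : M ↦ TangentSpace 𝓘(ℝ, E) x)]
  [IsRiemannianManifold 𝓘(ℝ, E) M]
  {F : Type*} [NormedAddCommGroup F] [NormedSpace ℝ F]

open MeasureTheory Manifold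

theorem dist_extChartAt_symm_le (x : M) (G : F →L[ℝ] E) {r : ℝ} (hr : 0 ≤ r) {s : Set E}
    (hs : Convex ℝ s) (hst : s ⊆ (extChartAt 𝓘(ℝ, E) x).target)
    (hG : ∀ e ∈ s, ∀ u : F, ‖(mfderiv% (extChartAt 𝓘(ℝ, E) x).symm e) (G u)‖ ≤ r * ‖u‖)
    {e : E} {z w : F} (hz : e + G z ∈ s) (hw : e + G w ∈ s) :
    dist ((extChartAt 𝓘(ℝ, E) x).symm (e + G z)) ((extChartAt 𝓘(ℝ, E) x).symm (e + G w)) ≤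
      r * ‖z - w‖ := by
  let η : ℝ →ᴬ[ℝ] E := ContinuousAffineMap.lineMap (R := ℝ) (e + G z) (e + G w)
  let γ := (extChartAt 𝓘(ℝ, E) x).symm ∘ η
  have hη : Icc 0 1 ⊆ η ⁻¹' s := by
    simp only [← image_subset_iff, ContinuousAffineMap.coe_lineMap_eq,
      ← segment_eq_image_lineMap, η]
    exact hs.segment_subset hz hw
  have η_smooth : CMDiff[Icc 0 1] 1 η :=
    (contMDiff_iff_contDiff.2 η.contDiff).contMDiffOn
  have h1 : riemannianEDist 𝓘(ℝ, E) (γ 0) (γ 1) ≤ pathELength 𝓘(ℝ, E) γ 0 1 :=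
    riemannianEDist_le_pathELength ((contMDiffOn_extChartAt_symm x).comp η_smooth
      (hη.trans (preimage_mono hst))) rfl rfl zero_le_one
  have h2 : pathELength 𝓘(ℝ, E) γ 0 1 ≤ ENNReal.ofReal (r * ‖z - w‖) := by
    rw [pathELength_eq_lintegral_mfderivWithin_Icc]
    calc _ ≤ ∫⁻ _ in Icc (0 : ℝ) 1, ENNReal.ofReal (r * ‖z - w‖) := by
          apply setLIntegral_mono' measurableSet_Icc (fun t ht ↦ ?_)
          have hd : mfderiv[Icc 0 1] γ t =
              (mfderiv% (extChartAt 𝓘(ℝ, E) x).symm (η t)) ∘L (mfderiv[Icc 0 1] η t) := by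
            apply mfderiv_comp_mfderivWithin
            · have := mdifferentiableWithinAt_extChartAt_symm (I := 𝓘(ℝ, E)) (hst (hη ht))
              rwa [modelWithCornersSelf_coe, range_id, mdifferentiableWithinAt_univ] at this
            · exact η_smooth.mdifferentiableOn one_ne_zero t ht
            · rw [uniqueMDiffWithinAt_iff_uniqueDiffWithinAt]
              exact uniqueDiffOn_Icc zero_lt_one t ht
          have hη' : (mfderiv[Icc 0 1] η t) (1 : ℝ) = G (w - z) := by
            rw [mfderivWithin_eq_fderivWithin,
              fderivWithin_eq_fderiv (uniqueDiffOn_Icc zero_lt_one _ ht) η.differentiableAt]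
            have h : fderiv ℝ η t 1 = (e + G w) - (e + G z) := by simp [η]
            refine h.trans ?_
            rw [map_sub]
            abel
          have hd1 : mfderiv[Icc 0 1] γ t 1 =
              (mfderiv% (extChartAt 𝓘(ℝ, E) x).symm (η t)) (mfderiv[Icc 0 1] η t 1) :=
            congr($hd 1)
          rw [hd1.trans (congrArg (mfderiv% (extChartAt 𝓘(ℝ, E) x).symm (η t)) hη'), ← ofReal_norm]
          exact ENNReal.ofReal_le_ofReal ((hG _ (hη ht) _).trans_eq (by rw [norm_sub_rev]))
      _ = _ := by simp
  have h3 : edist (γ 0) (γ 1) ≤ ENNReal.ofReal (r * ‖z - w‖) := by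
    rw [IsRiemannianManifold.out (I := 𝓘(ℝ, E))]
    exact h1.trans h2
  rw [edist_dist, ENNReal.ofReal_le_ofReal_iff (by positivity)] at h3
  simpa [γ, η, ContinuousAffineMap.coe_lineMap_eq] using h3

theorem norm_extChartAt_sub_le (x : M) (G : E →L[ℝ] F) {r R : ℝ} (hr : 0 ≤ r)
    (hs : Metric.ball x R ⊆ (chartAt E x).source)
    (hG : ∀ y ∈ Metric.ball x R, ∀ v : TangentSpace 𝓘(ℝ, E) y,
      ‖G ((mfderiv% (extChartAt 𝓘(ℝ, E) x) y) v)‖ ≤ r * ‖v‖)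
    {y : M} (hy : y ∈ Metric.ball x R) :
    ‖G (extChartAt 𝓘(ℝ, E) x y - extChartAt 𝓘(ℝ, E) x x)‖ ≤ r * dist x y := by
  have key : ∀ c, dist x y < c → c ≤ R →
      ‖G (extChartAt 𝓘(ℝ, E) x y - extChartAt 𝓘(ℝ, E) x x)‖ ≤ r * c := by
    intro c hc hcR
    have hc0 : 0 ≤ c := dist_nonneg.trans hc.le
    have h1 : riemannianEDist 𝓘(ℝ, E) x y < ENNReal.ofReal c := by
      rw [← IsRiemannianManifold.out (I := 𝓘(ℝ, E)), edist_dist]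
      exact (ENNReal.ofReal_lt_ofReal_iff_of_nonneg dist_nonneg).2 hc
    obtain ⟨γ, hγx, hγy, γ_smooth, hγ, -⟩ :=
      exists_lt_locally_constant_of_riemannianEDist_lt h1 zero_lt_one
    have hmem : ∀ t ∈ Icc (0 : ℝ) 1, γ t ∈ Metric.ball x R := fun t ht ↦ by
      have h2 : edist x (γ t) < ENNReal.ofReal c := by
        rw [IsRiemannianManifold.out (I := 𝓘(ℝ, E))]
        exact ((riemannianEDist_le_pathELength γ_smooth.contMDiffOn hγx rfl ht.1).trans
          (pathELength_mono le_rfl ht.2)).trans_lt hγ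
      rw [edist_dist, ENNReal.ofReal_lt_ofReal_iff_of_nonneg dist_nonneg, dist_comm] at h2
      exact h2.trans_le hcR
    let γ' : ℝ → E := extChartAt 𝓘(ℝ, E) x ∘ γ
    have hC : CMDiff[Icc 0 1] 1 γ' :=
      contMDiffOn_extChartAt.comp (I' := 𝓘(ℝ, E)) (t := (chartAt E x).source)
        γ_smooth.contMDiffOn (fun t ht ↦ hs (hmem t ht))
    have hC' : ContDiffOn ℝ 1 γ' (Icc 0 1) := contMDiffOn_iff_contDiffOn.1 hC
    have h2 : ‖G (γ' 1) - G (γ' 0)‖ₑ ≤ ENNReal.ofReal (r * c) := by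
      calc
        _ ≤ ∫⁻ t in Icc (0 : ℝ) 1, ‖derivWithin (fun t ↦ G (γ' t)) (Icc 0 1) t‖ₑ := by
          exact enorm_sub_le_lintegral_derivWithin_Icc_of_contDiffOn_Icc
            (G.contDiff.comp_contDiffOn hC') zero_le_one
        _ ≤ ∫⁻ t in Icc (0 : ℝ) 1, ENNReal.ofReal r * ‖mfderiv[Icc 0 1] γ t 1‖ₑ := by
          apply setLIntegral_mono' measurableSet_Icc (fun t ht ↦ ?_)
          have hu : UniqueDiffWithinAt ℝ (Icc (0 : ℝ) 1) t := uniqueDiffOn_Icc zero_lt_one _ ht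
          have hd : mfderiv[Icc 0 1] γ' t =
              (mfderiv% (extChartAt 𝓘(ℝ, E) x) (γ t)) ∘L (mfderiv[Icc 0 1] γ t) := by
            apply mfderiv_comp_mfderivWithin
            · exact mdifferentiableAt_extChartAt (hs (hmem t ht))
            · exact (γ_smooth.mdifferentiable one_ne_zero).mdifferentiableOn _ ht
            · rwa [uniqueMDiffWithinAt_iff_uniqueDiffWithinAt]
          have hd1 : mfderiv[Icc 0 1] γ' t 1 =
              (mfderiv% (extChartAt 𝓘(ℝ, E) x) (γ t)) (mfderiv[Icc 0 1] γ t 1) :=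
            congr($hd 1)
          have hder : derivWithin (fun t ↦ G (γ' t)) (Icc 0 1) t = G (mfderiv[Icc 0 1] γ' t 1) := by
            have h := (hC'.differentiableOn one_ne_zero t ht).hasDerivWithinAt
            refine ((G.hasFDerivAt.comp_hasDerivWithinAt t h).derivWithin hu).trans (congrArg G ?_)
            rw [mfderivWithin_eq_fderivWithin, ← fderivWithin_derivWithin]
            rfl
          rw [hder.trans (congrArg G hd1), ← ofReal_norm, ← ofReal_norm, ← ENNReal.ofReal_mul hr]
          exact ENNReal.ofReal_le_ofReal (hG _ (hmem t ht) _)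
        _ = ENNReal.ofReal r * pathELength 𝓘(ℝ, E) γ 0 1 := by
          rw [lintegral_const_mul' _ _ ENNReal.ofReal_ne_top,
            pathELength_eq_lintegral_mfderivWithin_Icc]
        _ ≤ ENNReal.ofReal (r * c) := by
          rw [ENNReal.ofReal_mul hr]
          gcongr
    rw [← ofReal_norm, ENNReal.ofReal_le_ofReal_iff (by positivity), ← map_sub] at h2
    simpa [γ', hγx, hγy] using h2
  have hd : Tendsto (fun c : ℝ ↦ r * c) (𝓝[>] (dist x y)) (𝓝 (r * dist x y)) :=
    ((continuous_const.mul continuous_id).tendsto _).mono_left nhdsWithin_le_nhds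
  refine ge_of_tendsto hd ?_
  have hyR : dist x y < R := by rw [dist_comm]; exact hy
  filter_upwards [self_mem_nhdsWithin, mem_nhdsWithin_of_mem_nhds (Iio_mem_nhds hyR)] with c h1 h2
  exact key c h1 (le_of_lt h2)

end Riemannian

section Riemannian

variable {E : Type*} [NormedAddCommGroup E] [NormedSpace ℝ E]
  {M : Type*} [MetricSpace M] [ChartedSpace E M] [IsManifold 𝓘(ℝ, E) 1 M]
  [Bundle.RiemannianBundle (fun x : M ↦ TangentSpace 𝓘(ℝ, E) x)]
  [IsRiemannianManifold 𝓘(ℝ, E) M]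

open Manifold

section

variable {F : Type*} [NormedAddCommGroup F] [NormedSpace ℝ F]

theorem exists_almostIsometricParam_of_bounds (x : M) (G : F ≃L[ℝ] E) {r : ℝ} (hr : 0 < r)
    (ha : ∀ᶠ y in 𝓝 x, ∀ v : TangentSpace 𝓘(ℝ, E) y,
      ‖G.symm ((mfderiv% (extChartAt 𝓘(ℝ, E) x) y) v)‖ ≤ r * ‖v‖)
    (hb : ∀ᶠ y in 𝓝 x, ∀ u : F,
      ‖(mfderiv% (extChartAt 𝓘(ℝ, E) x).symm (extChartAt 𝓘(ℝ, E) x y)) (G u)‖ ≤ r * ‖u‖) :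
    ∃ ρ, AlmostIsometricParam
      (fun z ↦ (extChartAt 𝓘(ℝ, E) x).symm (extChartAt 𝓘(ℝ, E) x x + G z)) x r ρ := by
  set φ := extChartAt 𝓘(ℝ, E) x with hφ
  have hsymm : ContinuousAt φ.symm (φ x) := continuousAt_extChartAt_symm x
  have hφφ : φ.symm (φ x) = x := extChartAt_to_inv x
  have htarget : ∀ᶠ e in 𝓝 (φ x), e ∈ φ.target := extChartAt_target_mem_nhds x
  obtain ⟨δ, hδ, hδb⟩ := Metric.eventually_nhds_iff_ball.1
    (htarget.and ((hsymm.tendsto.eventually (by rwa [hφφ])) :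
      ∀ᶠ e in 𝓝 (φ x), ∀ u : F, ‖(mfderiv% φ.symm (φ (φ.symm e))) (G u)‖ ≤ r * ‖u‖))
  have hsource : ∀ᶠ y in 𝓝 x, y ∈ (chartAt E x).source := chart_source_mem_nhds E x
  obtain ⟨R, hR, hRb⟩ := Metric.eventually_nhds_iff_ball.1 (hsource.and ha)
  have hG : ContinuousAt (fun z : F ↦ φ x + G z) 0 := by fun_prop
  have hG0 : Tendsto (fun z : F ↦ φ x + G z) (𝓝 0) (𝓝 (φ x)) := by simpa using hG.tendsto
  have hψ : Tendsto (fun z : F ↦ φ.symm (φ x + G z)) (𝓝 0) (𝓝 x) := by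
    have := hsymm.tendsto.comp hG0
    rwa [hφφ] at this
  obtain ⟨ρ, hρ, hρb⟩ := Metric.eventually_nhds_iff_ball.1
    ((hG0.eventually (Metric.ball_mem_nhds _ hδ)).and
      (hψ.eventually (Metric.ball_mem_nhds _ hR)))
  refine ⟨ρ, by simpa using hφφ, hρ, ?_, fun z hz w hw ↦ ?_, fun z hz ↦ ?_⟩
  · have hc : Tendsto (fun y ↦ G.symm (φ y - φ x)) (𝓝 x) (𝓝 0) := by
      have : ContinuousAt φ x := continuousAt_extChartAt x
      have h2 : ContinuousAt (fun y ↦ G.symm (φ y - φ x)) x := by fun_prop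
      simpa using h2.tendsto
    filter_upwards [hc.eventually (Metric.ball_mem_nhds _ hρ),
      extChartAt_source_mem_nhds (I := 𝓘(ℝ, E)) x] with y hy hys
    refine ⟨_, hy, ?_⟩
    simp only [ContinuousLinearEquiv.apply_symm_apply, add_sub_cancel]
    exact φ.left_inv hys
  · refine dist_extChartAt_symm_le x (G : F →L[ℝ] E) hr.le (convex_ball (φ x) δ)
      (fun e he ↦ (hδb e he).1) (fun e he u ↦ ?_) (hρb z hz).1 (hρb w hw).1
    have := (hδb e he).2 u
    rwa [φ.right_inv (hδb e he).1] at this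
  · have := norm_extChartAt_sub_le x (G.symm : E →L[ℝ] F) hr.le (fun y hy ↦ (hRb y hy).1)
      (fun y hy v ↦ (hRb y hy).2 v) (hρb z hz).2
    rw [← hφ, φ.right_inv (hδb _ (hρb z hz).1).1] at this
    simpa using this

omit [IsRiemannianManifold 𝓘(ℝ, E) M] in
theorem exists_strict_fderiv_param {f : M → ℝ} (hf : ContMDiff 𝓘(ℝ, E) 𝓘(ℝ, ℝ) 1 f) (x : M)
    (G : F ≃L[ℝ] E) {r : ℝ} (hr : 0 < r)
    (ha : ∀ v : TangentSpace 𝓘(ℝ, E) x,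
      ‖G.symm ((mfderiv% (extChartAt 𝓘(ℝ, E) x) x) v)‖ ≤ r * ‖v‖) :
    ∃ L : F →L[ℝ] ℝ, HasStrictFDerivAt
      (f ∘ fun z ↦ (extChartAt 𝓘(ℝ, E) x).symm (extChartAt 𝓘(ℝ, E) x x + G z)) L 0 ∧
      differentialNorm E f x ≤ ‖L‖ * r := by
  set φ := extChartAt 𝓘(ℝ, E) x with hφ
  have h1 : ContDiffAt ℝ 1 (f ∘ φ.symm) (φ x) := by
    rw [← contMDiffAt_iff_contDiffAt]
    have h := hf.comp_contMDiffOn (contMDiffOn_extChartAt_symm (I := 𝓘(ℝ, E)) (n := 1) x)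
    exact h.contMDiffAt (extChartAt_target_mem_nhds x)
  have h2 := h1.hasStrictFDerivAt one_ne_zero
  set D := fderiv ℝ (f ∘ φ.symm) (φ x) with hD
  refine ⟨D ∘L (G : F →L[ℝ] E), ?_, ?_⟩
  · have h3 : HasStrictFDerivAt (fun z : F ↦ φ x + G z) (G : F →L[ℝ] E) 0 :=
      (G : F →L[ℝ] E).hasStrictFDerivAt.const_add _
    refine HasStrictFDerivAt.comp (g := f ∘ φ.symm) 0 ?_ h3
    simpa using h2
  · have hcomp : mfderiv% f x = (mfderiv% (f ∘ φ.symm) (φ x)) ∘L (mfderiv% φ x) := by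
      rw [← mfderiv_comp x (h1.contMDiffAt.mdifferentiableAt one_ne_zero)
        (mdifferentiableAt_extChartAt (mem_chart_source E x))]
      refine Filter.EventuallyEq.mfderiv_eq ?_
      filter_upwards [extChartAt_source_mem_nhds (I := 𝓘(ℝ, E)) x] with y hy
      simp only [Function.comp_apply]
      rw [φ.left_inv hy]
    refine ContinuousLinearMap.opNorm_le_bound _ (by positivity) fun v ↦ ?_
    have hv : differentialAt (E := E) f x v =
        (D ∘L (G : F →L[ℝ] E)) (G.symm ((mfderiv% φ x) v)) := by
      refine (congr($hcomp v)).trans ?_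
      rw [mfderiv_eq_fderiv]
      exact congrArg D (G.apply_symm_apply _).symm
    rw [hv, mul_assoc]
    exact (ContinuousLinearMap.le_opNorm _ _).trans
      (mul_le_mul_of_nonneg_left (ha v) (norm_nonneg _))

end

variable [IsContinuousRiemannianBundle E (fun x : M ↦ TangentSpace 𝓘(ℝ, E) x)]

theorem exists_almostIsometricParam {f : M → ℝ} (hf : ContMDiff 𝓘(ℝ, E) 𝓘(ℝ, ℝ) 1 f) (x : M)
    {r : ℝ} (hr : 1 < r) :
    ∃ (ψ : TangentSpace 𝓘(ℝ, E) x → M) (ρ : ℝ) (L : TangentSpace 𝓘(ℝ, E) x →L[ℝ] ℝ),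
      AlmostIsometricParam ψ x r ρ ∧ HasStrictFDerivAt (f ∘ ψ) L 0 ∧
      differentialNorm E f x ≤ ‖L‖ * r := by
  set e := trivializationAt E (fun x : M ↦ TangentSpace 𝓘(ℝ, E) x) x with he
  let G : TangentSpace 𝓘(ℝ, E) x ≃L[ℝ] E :=
    e.continuousLinearEquivAt ℝ x (FiberBundle.mem_baseSet_trivializationAt' x)
  have hx := FiberBundle.mem_baseSet_trivializationAt' (F := E)
    (E := fun x : M ↦ TangentSpace 𝓘(ℝ, E) x) x
  have hG : ⇑G = e.continuousLinearMapAt ℝ x := e.coe_continuousLinearEquivAt_eq hx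
  have hG' : ⇑G.symm = e.symmL ℝ x := e.symm_continuousLinearEquivAt_eq hx
  have ha : ∀ᶠ y in 𝓝 x, ∀ v : TangentSpace 𝓘(ℝ, E) y,
      ‖G.symm ((mfderiv% (extChartAt 𝓘(ℝ, E) x) y) v)‖ ≤ r * ‖v‖ := by
    filter_upwards [eventually_norm_symmL_trivializationAt_self_comp_lt E
      (fun x : M ↦ TangentSpace 𝓘(ℝ, E) x) x hr, chart_source_mem_nhds E x] with y hy hys v
    rw [TangentBundle.continuousLinearMapAt_trivializationAt hys] at hy
    rw [hG']
    exact ContinuousLinearMap.le_of_opNorm_le _ hy.le v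
  have hb : ∀ᶠ y in 𝓝 x, ∀ u : TangentSpace 𝓘(ℝ, E) x,
      ‖(mfderiv% (extChartAt 𝓘(ℝ, E) x).symm (extChartAt 𝓘(ℝ, E) x y)) (G u)‖ ≤ r * ‖u‖ := by
    filter_upwards [eventually_norm_symmL_trivializationAt_comp_self_lt E
      (fun x : M ↦ TangentSpace 𝓘(ℝ, E) x) x hr, chart_source_mem_nhds E x] with y hy hys u
    rw [TangentBundle.symmL_trivializationAt hys] at hy
    have h := ContinuousLinearMap.le_of_opNorm_le _ hy.le u
    have hnorm : ∀ {p q : M}, p = q → ∀ v : E,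
        @norm (TangentSpace 𝓘(ℝ, E) p) _ v = @norm (TangentSpace 𝓘(ℝ, E) q) _ v := by
      rintro p _ rfl v
      rfl
    have hinv : (extChartAt 𝓘(ℝ, E) x).symm (extChartAt 𝓘(ℝ, E) x y) = y :=
      (extChartAt 𝓘(ℝ, E) x).left_inv (by simpa using hys)
    rw [hG, ← mfderivWithin_univ, ← range_id, ← modelWithCornersSelf_coe ℝ]
    exact (hnorm hinv _).trans_le h
  obtain ⟨ρ, hρ⟩ := exists_almostIsometricParam_of_bounds x G (by linarith) ha hb
  obtain ⟨L, hL, hL'⟩ := exists_strict_fderiv_param hf x G (by linarith) ha.self_of_nhds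
  exact ⟨_, ρ, L, hρ, hL, hL'⟩

theorem locallySteep_of_lt_differentialNorm {f : M → ℝ} (hf : ContMDiff 𝓘(ℝ, E) 𝓘(ℝ, ℝ) 1 f)
    {x : M} {κ : ℝ} (hκ : 0 < κ) (h : κ < differentialNorm E f x) : LocallySteep f κ x := by
  have hlim : Tendsto (fun r : ℝ ↦ κ * r ^ 2) (𝓝[>] 1) (𝓝 κ) := by
    have : ContinuousAt (fun r : ℝ ↦ κ * r ^ 2) 1 := by fun_prop
    simpa using this.tendsto.mono_left nhdsWithin_le_nhds
  obtain ⟨r, hr, hr1⟩ := ((hlim.eventually_lt_const h).and self_mem_nhdsWithin).exists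
  have hr1 : 1 < r := hr1
  obtain ⟨ψ, ρ, L, hψ, hL, hle⟩ := exists_almostIsometricParam hf x hr1
  refine hψ.locallySteep (by linarith) hL hκ (lt_of_mul_lt_mul_right (a := r) ?_ (by linarith))
  linarith [sq r]

theorem descentConnected_of_contMDiff {f : M → ℝ} (hf : ContMDiff 𝓘(ℝ, E) 𝓘(ℝ, ℝ) 1 f) (x : M) :
    DescentConnected f x := by
  intro κ₁ κ₂ h₂ h₁
  have hlim : Tendsto (fun r : ℝ ↦ κ₂ * r ^ 2) (𝓝[>] 1) (𝓝 κ₂) := by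
    have : ContinuousAt (fun r : ℝ ↦ κ₂ * r ^ 2) 1 := by fun_prop
    simpa using this.tendsto.mono_left nhdsWithin_le_nhds
  obtain ⟨r, hr, hr1⟩ := ((hlim.eventually_lt_const h₁).and self_mem_nhdsWithin).exists
  have hr1 : 1 < r := hr1
  obtain ⟨ψ, ρ, L, hψ, hL, -⟩ := exists_almostIsometricParam hf x hr1
  exact hψ.exists_descent_set hr1.le hL h₂ hr

end Riemannian

section Critical

variable {E : Type*} [NormedAddCommGroup E] [NormedSpace ℝ E]
  {M : Type*} [TopologicalSpace M] [ChartedSpace E M]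

theorem isCriticalPoint_of_isLocalMin {f : M → ℝ} {x : M} (h : IsLocalMin f x) :
    IsCriticalPoint E f x := by
  by_cases hd : MDifferentiableAt 𝓘(ℝ, E) 𝓘(ℝ, ℝ) f x
  · have hlm : IsLocalMin (f ∘ (chartAt E x).symm) (chartAt E x x) := by
      have hx := mem_chart_target E x
      refine IsMinFilter.comp_tendsto (by rwa [(chartAt E x).left_inv (mem_chart_source E x)]) ?_
      simpa [ContinuousAt] using (chartAt E x).continuousAt_symm hx
    have h1 := hlm.fderiv_eq_zero
    refine (if_pos hd).trans ?_
    simpa [writtenInExtChartAt, extChartAt, fderivWithin_univ] using! h1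
  · exact mfderiv_zero_of_not_mdifferentiableAt hd

theorem eventually_pos_of_isMorse [FiniteDimensional ℝ E] [IsManifold 𝓘(ℝ, E) ∞ M] {f : M → ℝ}
    (hf : ContMDiff 𝓘(ℝ, E) 𝓘(ℝ, ℝ) ∞ f) (hf_nonneg : ∀ x, 0 ≤ f x) (hf_morse : IsMorse E f)
    {x : M} (hx : IsCriticalPoint E f x) : ∀ᶠ y in 𝓝 x, y ≠ x → 0 < f y := by
  set φ := chartAt E x with hφ
  have hxs : x ∈ φ.source := mem_chart_source E x
  have hg : ContDiffAt ℝ 2 (f ∘ φ.symm) (φ x) := by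
    rw [← contMDiffAt_iff_contDiffAt]
    have h := hf.comp_contMDiffOn (contMDiffOn_chart_symm (I := 𝓘(ℝ, E)) (n := ∞) (x := x))
    exact (h.contMDiffAt (φ.open_target.mem_nhds (φ.map_source hxs))).of_le (by norm_cast)
  have hzero : ∀ z ∈ φ.target, f (φ.symm z) = 0 → fderiv ℝ (f ∘ φ.symm) z = 0 := fun z hz h0 ↦ by
    refine IsLocalMin.fderiv_eq_zero (Eventually.of_forall fun w ↦ ?_)
    simpa [h0] using hf_nonneg _
  have hd : DifferentiableAt ℝ (fderiv ℝ (f ∘ φ.symm)) (φ x) :=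
    (hg.fderiv_right (m := 1) (by norm_num)).differentiableAt one_ne_zero
  obtain ⟨K, hK, hanti⟩ := (chartHessian E f x : E →ₗ[ℝ] E →L[ℝ] ℝ).exists_antilipschitzWith
    (LinearMap.ker_eq_bot'.2 fun v hv ↦ hf_morse x hx v fun w ↦ congr($hv w))
  have hne : ∀ᶠ z in 𝓝[≠] (φ x), fderiv ℝ (f ∘ φ.symm) z ≠ 0 := by
    exact hd.hasFDerivAt.eventually_ne ⟨K, hanti⟩
  rw [eventually_nhdsWithin_iff] at hne
  filter_upwards [(φ.continuousAt hxs).eventually hne, φ.open_source.mem_nhds hxs] with y hy hys hyx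
  refine (hf_nonneg y).lt_of_ne fun h0 ↦ hy (fun h ↦ hyx (φ.injOn hys hxs h)) ?_
  exact hzero _ (φ.map_source hys) (by rw [φ.left_inv hys, h0])

end Critical

/-- An isolated zero of a nonnegative function on a locally compact space has arbitrarily small
neighborhoods on whose frontier the function is bounded below. -/
theorem exists_le_on_frontier {M : Type*} [MetricSpace M] [LocallyCompactSpace M] {f : M → ℝ}
    (hf : Continuous f) {x : M} (hpos : ∀ᶠ y in 𝓝 x, y ≠ x → 0 < f y) {U : Set M} (hU : U ∈ 𝓝 x) :
    ∃ A ⊆ U, x ∈ A ∧ ∃ η > 0, ∀ y ∈ frontier A, η ≤ f y := by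
  obtain ⟨K, hK, hKU, hKc⟩ := LocallyCompactSpace.local_compact_nhds x _ (inter_mem hU hpos)
  obtain ⟨R, hR, hRK⟩ := Metric.nhds_basis_closedBall.mem_iff.1 hK
  have hcomp : IsCompact (Metric.sphere x R) :=
    hKc.of_isClosed_subset Metric.isClosed_sphere (Metric.sphere_subset_closedBall.trans hRK)
  refine ⟨Metric.ball x R, fun y hy ↦ (hKU (hRK (Metric.ball_subset_closedBall hy))).1,
    Metric.mem_ball_self hR, ?_⟩
  rcases (Metric.sphere x R).eq_empty_or_nonempty with he | hne
  · exact ⟨1, one_pos, fun y hy ↦ by simpa [he] using Metric.frontier_ball_subset_sphere hy⟩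
  · obtain ⟨z, hz, hmin⟩ := hcomp.exists_isMinOn hne hf.continuousOn
    refine ⟨f z, (hKU (hRK (Metric.sphere_subset_closedBall hz))).2 ?_,
      fun y hy ↦ hmin (Metric.frontier_ball_subset_sphere hy)⟩
    rintro rfl
    simp at hz
    exact hR.ne hz

theorem LocallySteep.exists_lt {M : Type*} [MetricSpace M] {f : M → ℝ} {κ : ℝ} {x : M}
    (h : LocallySteep f κ x) : ∃ y, y ≠ x ∧ f y < f x ∧ κ * dist x y ≤ f x - f y := by
  obtain ⟨δ, hδ, hev⟩ := h
  obtain ⟨y, hxy, hy⟩ := hev.self_of_nhds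
  exact ⟨y, by rintro rfl; linarith, by linarith, hxy.le⟩

section

variable {E : Type*} [NormedAddCommGroup E] [NormedSpace ℝ E]
  {M : Type*} [MetricSpace M] [ChartedSpace E M] [IsManifold 𝓘(ℝ, E) 1 M]
  [Bundle.RiemannianBundle (fun x : M ↦ TangentSpace 𝓘(ℝ, E) x)]
  [IsContinuousRiemannianBundle E (fun x : M ↦ TangentSpace 𝓘(ℝ, E) x)]
  [IsRiemannianManifold 𝓘(ℝ, E) M] [CompleteSpace M]

theorem isGLB_range_zero_of_dominated [Nonempty M] {f : M → ℝ}
    (hf : ContMDiff 𝓘(ℝ, E) 𝓘(ℝ, ℝ) 1 f) (h0 : ∀ x, 0 ≤ f x)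
    (hdom : Dominated f (differentialNorm E f)) : IsGLB (range f) 0 := by
  obtain ⟨c, hc, hle⟩ := hdom
  refine ⟨by rintro _ ⟨x, rfl⟩; exact h0 x, fun b hb ↦ ?_⟩
  by_contra! hb0
  obtain ⟨x, -, hx⟩ := isClosed_univ.exists_caristi_minimal univ_nonempty hf.continuous h0
    (κ := b / (2 * c)) (by positivity)
  have hsteep : LocallySteep f (b / (2 * c)) x := by
    refine locallySteep_of_lt_differentialNorm (E := E) hf (by positivity) ?_
    have h1 : b ≤ f x := hb ⟨x, rfl⟩
    have h2 := hle x
    rw [div_lt_iff₀ (by positivity)]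
    linarith
  obtain ⟨y, hyx, -, hy⟩ := hsteep.exists_lt
  exact hyx (hx y trivial hy)

theorem exists_zero_of_sqrt_dominated [Nonempty M] {f : M → ℝ}
    (hf : ContMDiff 𝓘(ℝ, E) 𝓘(ℝ, ℝ) 1 f) (h0 : ∀ x, 0 ≤ f x)
    (hdom : Dominated (fun x ↦ Real.sqrt (f x)) (differentialNorm E f)) : ∃ x, f x = 0 := by
  obtain ⟨c, hc, hle⟩ := hdom
  obtain ⟨x, -, hx⟩ := isClosed_univ.exists_caristi_minimal univ_nonempty hf.continuous.sqrt
    (fun x ↦ Real.sqrt_nonneg (f x)) (κ := 1 / (4 * c)) (by positivity)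
  refine ⟨x, by_contra fun hne ↦ ?_⟩
  have hpos : 0 < √(f x) := Real.sqrt_pos.2 ((h0 x).lt_of_ne' hne)
  have hsteep : LocallySteep f (√(f x) / (2 * c)) x := by
    refine locallySteep_of_lt_differentialNorm (E := E) hf (by positivity) ?_
    have h2 := hle x
    rw [div_lt_iff₀ (by positivity)]
    linarith
  obtain ⟨y, hyx, hlt, hy⟩ := hsteep.exists_lt
  refine hyx (hx y trivial ?_)
  have e1 := Real.sq_sqrt (h0 x)
  have e2 := Real.sq_sqrt (h0 y)
  have e3 := Real.sqrt_le_sqrt hlt.le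
  have e4 : √(f x) * (1 / (2 * c) * dist x y) ≤ √(f x) * (2 * (√(f x) - √(f y))) := by
    calc _ = √(f x) / (2 * c) * dist x y := by ring
      _ ≤ f x - f y := hy
      _ = (√(f x) + √(f y)) * (√(f x) - √(f y)) := by linear_combination -e1 + e2
      _ ≤ (2 * √(f x)) * (√(f x) - √(f y)) :=
        mul_le_mul_of_nonneg_right (by linarith) (by linarith)
      _ = _ := by ring
  have e5 := le_of_mul_le_mul_left e4 hpos
  have e6 : 1 / (4 * c) * dist x y = 1 / (2 * c) * dist x y / 2 := by field_simp; ring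
  rw [e6]
  linarith

theorem tendsto_of_tendsto_zero [PreconnectedSpace M] [LocallyCompactSpace M] {f : M → ℝ}
    (hf : ContMDiff 𝓘(ℝ, E) 𝓘(ℝ, ℝ) 1 f) (h0 : ∀ x, 0 ≤ f x)
    (hdom : Dominated f (differentialNorm E f)) {x₀ : M} (hx₀ : f x₀ = 0)
    (hpos : ∀ᶠ y in 𝓝 x₀, y ≠ x₀ → 0 < f y) {ι : Type*} {l : Filter ι} {u : ι → M}
    (hu : Tendsto (fun i ↦ f (u i)) l (𝓝 0)) : Tendsto u l (𝓝 x₀) := by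
  obtain ⟨c, hc, hle⟩ := hdom
  intro U hU
  obtain ⟨A, hAU, hxA, η, hη, hA⟩ := exists_le_on_frontier hf.continuous hpos hU
  filter_upwards [hu.eventually_lt_const hη] with i hi
  refine hAU (mem_of_lt_of_frontier_le hf.continuous h0 (κ := η / (4 * c)) (by positivity) hη
    (fun x hx ↦ ?_) (fun x ↦ descentConnected_of_contMDiff (E := E) hf x) hA hxA
    (by rwa [hx₀]) hi)
  refine locallySteep_of_lt_differentialNorm (E := E) hf (by positivity) ?_
  have h2 := hle x
  rw [div_lt_iff₀ (by positivity)]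
  linarith

end

theorem mainTheorem5
    {E : Type*} [NormedAddCommGroup E] [NormedSpace ℝ E] [FiniteDimensional ℝ E]
    {M : Type*} [MetricSpace M] [ChartedSpace E M] [IsManifold 𝓘(ℝ, E) ∞ M]
    [Bundle.RiemannianBundle (fun x : M ↦ TangentSpace 𝓘(ℝ, E) x)]
    [IsContMDiffRiemannianBundle 𝓘(ℝ, E) ∞ E (fun x : M ↦ TangentSpace 𝓘(ℝ, E) x)]
    [IsRiemannianManifold 𝓘(ℝ, E) M] [ConnectedSpace M] [CompleteSpace M]
    (f : M → ℝ) (hf : ContMDiff 𝓘(ℝ, E) 𝓘(ℝ, ℝ) ∞ f)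
    (hf_nonneg : ∀ x : M, 0 ≤ f x) (hf_morse : IsMorse E f)
    (hf_grad : Dominated f (differentialNorm E f)) :
    (∀ x : M, IsCriticalPoint E f x ↔ f x = 0) ∧
    (∀ x : M, IsCriticalPoint E f x → IsLocalMin f x) ∧
    IsGLB (range f) 0 ∧
    (∀ xmin : M, (∀ y : M, f xmin ≤ f y) →
      f xmin = 0 ∧
      ∀ x : ℕ → M, Tendsto (fun n ↦ f (x n)) atTop (𝓝 0) → Tendsto x atTop (𝓝 xmin)) ∧
    (∀ x y : M, IsCriticalPoint E f x → IsCriticalPoint E f y → x = y) ∧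
    (Dominated (fun x ↦ Real.sqrt (f x)) (differentialNorm E f) →
      ∃! x : M, IsCriticalPoint E f x) := by
  have : IsContinuousRiemannianBundle E (fun x : M ↦ TangentSpace 𝓘(ℝ, E) x) := by
    obtain ⟨g, hg, hgi⟩ := IsContMDiffRiemannianBundle.exists_contMDiff (IB := 𝓘(ℝ, E)) (n := ∞)
      (F := E) (E := fun x : M ↦ TangentSpace 𝓘(ℝ, E) x)
    exact ⟨g, hg.continuous, hgi⟩
  have hf1 : ContMDiff 𝓘(ℝ, E) 𝓘(ℝ, ℝ) 1 f := hf.of_le (by norm_cast)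
  have hmin : ∀ x, f x = 0 → IsLocalMin f x := fun x hx ↦
    Eventually.of_forall fun y ↦ by rw [hx]; exact hf_nonneg y
  have hcrit : ∀ x : M, IsCriticalPoint E f x ↔ f x = 0 := by
    refine fun x ↦ ⟨fun hx ↦ ?_, fun hx ↦ isCriticalPoint_of_isLocalMin (hmin x hx)⟩
    obtain ⟨c, -, hle⟩ := hf_grad
    have h := hle x
    have hn : differentialNorm E f x = 0 := (congrArg norm hx).trans
      (norm_zero (E := TangentSpace 𝓘(ℝ, E) x →L[ℝ] ℝ))
    rw [hn, mul_zero] at h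
    exact h.antisymm (hf_nonneg x)
  have hglb := isGLB_range_zero_of_dominated (E := E) hf1 hf_nonneg hf_grad
  have : LocallyCompactSpace M := ChartedSpace.locallyCompactSpace E M
  have hconv : ∀ x : M, f x = 0 → ∀ u : ℕ → M, Tendsto (fun n ↦ f (u n)) atTop (𝓝 0) →
      Tendsto u atTop (𝓝 x) := fun x hx u hu ↦
    tendsto_of_tendsto_zero (E := E) hf1 hf_nonneg hf_grad hx
      (eventually_pos_of_isMorse hf hf_nonneg hf_morse ((hcrit x).2 hx)) hu
  have huniq : ∀ x y : M, IsCriticalPoint E f x → IsCriticalPoint E f y → x = y := by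
    intro x y hx hy
    rw [hcrit] at hx hy
    exact (tendsto_const_nhds_iff.1 (hconv x hx (fun _ ↦ y) (by simp [hy]))).symm
  refine ⟨hcrit, fun x hx ↦ hmin x ((hcrit x).1 hx), hglb, fun x hx ↦ ?_, huniq, fun hsqrt ↦ ?_⟩
  · have h0 : f x = 0 :=
      (hglb.2 (by rintro _ ⟨y, rfl⟩; exact hx y)).antisymm (hf_nonneg x)
    exact ⟨h0, hconv x h0⟩
  · obtain ⟨x, hx⟩ := exists_zero_of_sqrt_dominated (E := E) hf1 hf_nonneg hsqrt
    exact ⟨x, (hcrit x).2 hx, fun y hy ↦ huniq y x hy ((hcrit x).2 hx)⟩
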